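/- **Setting.** Let $p,\nu,\xi$ be real constants with $\nu>0$, $0<p<\min\{\tfrac12,\nu^2\}$ and $p+\nu^2<\xi$. For every $h\in\mathbb N$ let the following be given. * *Dictionary.* Vectors $A^*_1,\dots,A^*_h\in\mathbb R^{n}$ ($n=n(h)$) with $\|A^*_i\|_2=1$ and $|\langle A^*_i,A^*_j\rangle|\le h^{-\xi}$ for $i\ne j$; let $A^*$ be the $n\times h$ matrix with these columns. * *Sparse code.* Real numbers $0\le a\le b$, $m_1\ge 0$, $m_2$ (all depending on $h$) and a random vector $x^*\in(\mathbb R^{\ge0})^h$ generated as follows. A random set $S\subseteq\{1,\dots,h\}$ is drawn from a distribution supported on sets of size at most $h^p$, such that $\Pr[i\in S]$ does not depend on $i$ and $\Pr[i,j\in S]$ does not depend on the pair $i\neq j$. Given $S$, $x^*$ is drawn from a distribution $D_S$ under which $x^*_i=0$ almost surely for $i\notin S$, the coordinates $(x^*_i)_{i\in S}$ are independent, and for every $i\in S$: $x^*_i\in[a,b]$ almost surely, $\mathbb E_{D_S}[x_i^*]=m_1$ and $\mathbb E_{D_S}[(x_i^*)^2]=m_2$. * *Autoencoder.* A number $\delta=\delta(h)$;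 for $W\in\mathbb R^{h\times n}$ with rows $W_1,\dots,W_h$, put $y=A^*x^*$, let $\epsilon\in\mathbb R^h$ be the bias all of whose entries are $2m_1h^p(\delta+h^{-\xi})$, and let $L=\tfrac12\|W^\top\mathrm{ReLU}(Wy-\epsilon)-y\|_2^2$. Assume that, as $h\to\infty$, $\delta=O(h^{-p-\nu^2})$, $a=\Omega(b\,h^{-\nu^2})$, and that $\exp\!\big(\tfrac{h^pm_1^2}{2(b-a)^2}\big)$ is superpolynomial in $h$, i.e. grows faster than $h^d$ for every $d$. **Theorem.** There is a function $g(h)=o\big(\max\{m_1^2,m_2\}/h^{1-p}\big)$ such that for all sufficiently large $h$, for every $W$ with $\|W_i-A^*_i\|_2\le\delta$ for all $i$, and for every $i=1,\dots,h$, the random vector $\partial L/\partial W_i$ is integrable and $$\Big\|\mathbb E\Big[\frac{\partial L}{\partial W_i}\Big]\Big\|_2\le g(h).$$ Here, on the event $\langle W_i,y\rangle=\epsilon_i$, where $L$ may fail to be differentiable in $W_i$, $\partial L/\partial W_i$ denotes the value given by the chain rule with $\mathrm{ReLU}'(0)=\tau$, where $\tau\in[0,1]$ is arbitrary; $g$ does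 not depend on $\tau$, $W$ or $i$. -/

import Mathlib

open MeasureTheory ProbabilityTheory Filter Asymptotics

noncomputable section

/-- Output `Wᵀ ReLU (W y - ε)` of the autoencoder; `W i` is the `i`-th row of the weight matrix. -/
def autoencoder {n h : ℕ} (W : Fin h → EuclideanSpace ℝ (Fin n)) (ε : Fin h → ℝ)
    (y : EuclideanSpace ℝ (Fin n)) : EuclideanSpace ℝ (Fin n) :=
  ∑ j, max 0 (inner ℝ (W j) y - ε j) • W j

/-- Squared reconstruction loss. -/
def aeLoss {n h : ℕ} (W : Fin h → EuclideanSpace ℝ (Fin n)) (ε : Fin h → ℝ)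
    (y : EuclideanSpace ℝ (Fin n)) : ℝ :=
  (1 / 2) * ‖autoencoder W ε y - y‖ ^ 2

/-- The partial gradient `∂L/∂W_i`. The loss is differentiable in `W_i` whenever
`⟨W_i, y⟩ ≠ ε_i` (see `hasGradientAt_aeLoss`). On the kink `⟨W_i, y⟩ = ε_i` it is the value given
by the chain rule when the derivative of `ReLU` at `0` is taken to be `τ`. -/
def aeGrad {n h : ℕ} (τ : ℝ) (W : Fin h → EuclideanSpace ℝ (Fin n)) (ε : Fin h → ℝ)
    (y : EuclideanSpace ℝ (Fin n)) (i : Fin h) : EuclideanSpace ℝ (Fin n) :=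
  if inner ℝ (W i) y = ε i then
    (τ * inner ℝ (W i) (autoencoder W ε y - y)) • y
  else
    gradient (fun w => aeLoss (Function.update W i w) ε y) (W i)

/-- Unit columns with pairwise coherence at most `h ^ (-ξ)`; `A i` is the `i`-th column. -/
structure IsIncoherentDictionary {n h : ℕ} (A : Fin h → EuclideanSpace ℝ (Fin n)) (ξ : ℝ) :
    Prop where
  norm_eq_one : ∀ i, ‖A i‖ = 1
  incoherent : ∀ i j, i ≠ j → |inner ℝ (A i) (A j)| ≤ (h : ℝ) ^ (-ξ)

/-- The signal `y = A x`. -/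
def signal {n h : ℕ} (A : Fin h → EuclideanSpace ℝ (Fin n)) (x : Fin h → ℝ) :
    EuclideanSpace ℝ (Fin n) :=
  ∑ j, x j • A j

/-- The assumptions on the law of the sparse code: a support `S` is drawn from `P`, then the code
is drawn from `D S`. The family of possible supports is the set of `S` with `P S ≠ 0`. -/
structure IsSparseCode {h : ℕ} (P : PMF (Finset (Fin h)))
    (D : Finset (Fin h) → Measure (Fin h → ℝ)) (p a b m₁ m₂ : ℝ) : Prop where
  card_le : ∀ S, P S ≠ 0 → (S.card : ℝ) ≤ (h : ℝ) ^ p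
  prob_single : ∃ q₁, ∀ i, P.toOuterMeasure {S | i ∈ S} = q₁
  prob_pair : ∃ q₂, ∀ i j, i ≠ j → P.toOuterMeasure {S | i ∈ S ∧ j ∈ S} = q₂
  isProbabilityMeasure : ∀ S, P S ≠ 0 → IsProbabilityMeasure (D S)
  support_subset : ∀ S, P S ≠ 0 → ∀ i, i ∉ S → ∀ᵐ x ∂(D S), x i = 0
  a_nonneg : 0 ≤ a
  mem_Icc : ∀ S, P S ≠ 0 → ∀ i ∈ S, ∀ᵐ x ∂(D S), x i ∈ Set.Icc a b
  indep : ∀ S, P S ≠ 0 → iIndepFun (fun (i : S) (x : Fin h → ℝ) => x i) (D S)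
  mean_eq : ∀ S, P S ≠ 0 → ∀ i ∈ S, ∫ x, x i ∂(D S) = m₁
  second_moment_eq : ∀ S, P S ≠ 0 → ∀ i ∈ S, ∫ x, x i ^ 2 ∂(D S) = m₂
  -- follows from the previous fields unless the support is almost surely empty
  mean_nonneg : 0 ≤ m₁

/-- The law of the sparse code: the mixture of the `D S` with weights `P S`. -/
def codeLaw {h : ℕ} (P : PMF (Finset (Fin h))) (D : Finset (Fin h) → Measure (Fin h → ℝ)) :
    Measure (Fin h → ℝ) :=
  ∑ S, P S • D S

/-- `f` grows faster than every polynomial. -/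
def Superpolynomial (f : ℕ → ℝ) : Prop :=
  ∀ d : ℕ, (fun h : ℕ => (h : ℝ) ^ d) =o[atTop] f

/-- The bias `2 m₁ k (δ + h ^ (-ξ))` with `k = h ^ p`, the same for every hidden unit. -/
def aeBias (h : ℕ) (p ξ m₁ δ : ℝ) : Fin h → ℝ :=
  fun _ => 2 * m₁ * (h : ℝ) ^ p * (δ + (h : ℝ) ^ (-ξ))

/-- Away from the kink the loss is differentiable in `W_i`, with the expected gradient. -/
theorem hasGradientAt_aeLoss {n h : ℕ} (W : Fin h → EuclideanSpace ℝ (Fin n)) (ε : Fin h → ℝ)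
    (y : EuclideanSpace ℝ (Fin n)) (i : Fin h) (hi : inner ℝ (W i) y ≠ ε i) :
    HasGradientAt (fun w => aeLoss (Function.update W i w) ε y)
      ((if ε i < inner ℝ (W i) y then (1 : ℝ) else 0) •
        ((inner ℝ (W i) y - ε i) • (autoencoder W ε y - y)
          + inner ℝ (W i) (autoencoder W ε y - y) • y)) (W i) := by
  have key : ∀ w, autoencoder (Function.update W i w) ε y
      = max 0 (inner ℝ w y - ε i) • w
        + ∑ j ∈ Finset.univ.erase i, max 0 (inner ℝ (W j) y - ε j) • W j := by
    intro w
    unfold autoencoder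
    rw [← Finset.add_sum_erase _ _ (Finset.mem_univ i)]
    congr 1
    · simp
    · refine Finset.sum_congr rfl fun j hj => ?_
      rw [Function.update_of_ne (Finset.ne_of_mem_erase hj)]
  set C := ∑ j ∈ Finset.univ.erase i, max 0 (inner ℝ (W j) y - ε j) • W j with hC
  have hW : autoencoder W ε y = max 0 (inner ℝ (W i) y - ε i) • W i + C := by
    rw [← key (W i), Function.update_eq_self]
  have hcont : Continuous fun w : EuclideanSpace ℝ (Fin n) => inner ℝ w y := by fun_prop
  rcases lt_or_gt_of_ne hi with hlt | hgt
  · rw [if_neg (not_lt.mpr hlt.le), zero_smul]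
    have hev : (fun w => aeLoss (Function.update W i w) ε y)
        =ᶠ[nhds (W i)] fun _ => (1 / 2) * ‖C - y‖ ^ 2 := by
      filter_upwards [hcont.continuousAt.eventually_lt continuousAt_const hlt] with w hw
      simp only [aeLoss, key w, max_eq_left (sub_nonpos.mpr (le_of_lt hw)), zero_smul, zero_add]
    exact (hasGradientAt_const _ _).congr_of_eventuallyEq hev
  · rw [if_pos hgt, one_smul]
    have hev : (fun w => aeLoss (Function.update W i w) ε y)
        =ᶠ[nhds (W i)] fun w => (1 / 2) * ‖(inner ℝ w y - ε i) • w + C - y‖ ^ 2 := by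
      filter_upwards [continuousAt_const.eventually_lt hcont.continuousAt hgt] with w hw
      simp only [aeLoss, key w, max_eq_right (sub_nonneg.mpr (le_of_lt hw))]
    refine HasGradientAt.congr_of_eventuallyEq ?_ hev
    rw [hW, max_eq_right (sub_nonneg.mpr hgt.le), hasGradientAt_iff_hasFDerivAt]
    have h1 : HasFDerivAt (fun w : EuclideanSpace ℝ (Fin n) => inner ℝ w y - ε i)
        (innerSL ℝ y) (W i) := by
      have := (innerSL ℝ y).hasFDerivAt (x := W i)
      simpa [real_inner_comm] using this.sub_const (ε i)
    have h2 := (((h1.smul (hasFDerivAt_id (W i))).add_const C).sub_const y).norm_sq.const_mul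
      (1 / 2 : ℝ)
    refine h2.congr_fderiv ?_
    ext v
    have e : ((fun w : EuclideanSpace ℝ (Fin n) => inner ℝ w y - ε i) • id) (W i)
        = (inner ℝ (W i) y - ε i) • W i := rfl
    rw [e]
    generalize (inner ℝ (W i) y - ε i) • W i + C - y = R
    simp [real_inner_comm]
    ring

end

/-! The expected gradient is small because the gradient itself is small with overwhelming
probability; no cancellation between samples is needed. Put `k = h ^ p`, `η = δ + h ^ (-ξ)`, so that
the bias is `ε = 2 m₁ k η`. The rows of `W` are almost dual to the dictionary, with error `η`, hence
`⟨W_i, y⟩` differs from `x_i` by at most `η ∑ x_j`. When `∑ x_j < 2 m₁ k` this error is below the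
bias. Units off the support are then silent and have zero gradient
(`aeGrad_eq_zero_of_code_eq_zero`). Activations on the support equal `x_j` up to `2ε`, which makes
the residual, and with it the gradient, small (`norm_aeGrad_le_of_sum_lt`). As `ε k ≤ m₁ ρ` with `ρ
= O(h ^ (p - ν²))`, and `i` is in the support with probability at most `h ^ (p - 1)`, this event
contributes `O(ρ m₁² h ^ (p - 1))`.

The complementary event has superpolynomially small probability by Hoeffding's inequality
(`measureReal_le_sum_le`), and there a polynomial bound suffices (`norm_aeGrad_le_of_le`), since `b`
is at most `m₁` times a power of `h`. The slope `τ` enters only as a factor in `[0, 1]`, so the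
bound is uniform in it. -/

/-! ### The gradient formula, its norm and its measurability. -/

/-- The gradient formula holds on the kink as well, with slope `τ` there. -/
theorem aeGrad_eq_smul {n h : ℕ} (τ : ℝ) (W : Fin h → EuclideanSpace ℝ (Fin n)) (ε : Fin h → ℝ)
    (y : EuclideanSpace ℝ (Fin n)) (i : Fin h) :
    aeGrad τ W ε y i =
      (if inner ℝ (W i) y = ε i then τ else if ε i < inner ℝ (W i) y then 1 else 0) •
        ((inner ℝ (W i) y - ε i) • (autoencoder W ε y - y)
          + inner ℝ (W i) (autoencoder W ε y - y) • y) := by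
  unfold aeGrad
  split_ifs with h1 h2
  · rw [h1, sub_self, zero_smul, zero_add, smul_smul]
  · simpa [h2] using (hasGradientAt_aeLoss W ε y i h1).gradient
  · simpa [h2] using (hasGradientAt_aeLoss W ε y i h1).gradient

theorem aeGrad_eq_zero_of_inner_lt {n h : ℕ} (τ : ℝ) (W : Fin h → EuclideanSpace ℝ (Fin n))
    (ε : Fin h → ℝ) (y : EuclideanSpace ℝ (Fin n)) (i : Fin h) (hi : inner ℝ (W i) y < ε i) :
    aeGrad τ W ε y i = 0 := by
  rw [aeGrad_eq_smul, if_neg hi.ne, if_neg hi.not_gt, zero_smul]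

theorem norm_aeGrad_le {n h : ℕ} {τ : ℝ} (hτ : τ ∈ Set.Icc (0 : ℝ) 1)
    (W : Fin h → EuclideanSpace ℝ (Fin n)) (ε : Fin h → ℝ) (y : EuclideanSpace ℝ (Fin n))
    (i : Fin h) :
    ‖aeGrad τ W ε y i‖ ≤ |inner ℝ (W i) y - ε i| * ‖autoencoder W ε y - y‖
      + |inner ℝ (W i) (autoencoder W ε y - y)| * ‖y‖ := by
  rw [aeGrad_eq_smul, norm_smul]
  have hs : ‖(if inner ℝ (W i) y = ε i then τ else if ε i < inner ℝ (W i) y then 1 else 0 : ℝ)‖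
      ≤ 1 := by
    split_ifs
    · rw [Real.norm_of_nonneg hτ.1]; exact hτ.2
    · simp
    · simp
  refine (mul_le_of_le_one_left (norm_nonneg _) hs).trans ((norm_add_le _ _).trans_eq ?_)
  simp only [norm_smul, Real.norm_eq_abs]

theorem continuous_autoencoder {n h : ℕ} (W : Fin h → EuclideanSpace ℝ (Fin n)) (ε : Fin h → ℝ) :
    Continuous (autoencoder W ε) := by
  unfold autoencoder
  fun_prop

theorem continuous_signal {n h : ℕ} (A : Fin h → EuclideanSpace ℝ (Fin n)) :
    Continuous (signal A) := by
  unfold signal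
  fun_prop

theorem measurable_aeGrad {n h : ℕ} (τ : ℝ) (W : Fin h → EuclideanSpace ℝ (Fin n))
    (ε : Fin h → ℝ) (i : Fin h) : Measurable fun y => aeGrad τ W ε y i := by
  simp only [aeGrad_eq_smul]
  have hin : Continuous fun y : EuclideanSpace ℝ (Fin n) => inner ℝ (W i) y := by fun_prop
  have hout := continuous_autoencoder W ε
  have hg : Continuous fun y => (inner ℝ (W i) y - ε i) • (autoencoder W ε y - y)
      + inner ℝ (W i) (autoencoder W ε y - y) • y := by
    fun_prop
  have hs : Measurable fun y : EuclideanSpace ℝ (Fin n) =>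
      (if inner ℝ (W i) y = ε i then τ else if ε i < inner ℝ (W i) y then 1 else 0 : ℝ) :=
    Measurable.ite (measurableSet_eq_fun hin.measurable measurable_const) measurable_const
      (Measurable.ite (measurableSet_lt measurable_const hin.measurable) measurable_const
        measurable_const)
  exact hs.smul hg.measurable

/-- The error scales with the total mass `∑ c j`, not with the number of vectors. It serves both for
the signal (`V = A`, `c = x`) and for the output (`V = W`, `c` the activations). -/
theorem abs_inner_sum_smul_sub_le {E ι : Type*} [NormedAddCommGroup E] [InnerProductSpace ℝ E]
    [Fintype ι] [DecidableEq ι] (w : E) (V : ι → E) (c : ι → ℝ) (i : ι) (κ : ℝ)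
    (hc : ∀ j, 0 ≤ c j) (hκ : ∀ j, |inner ℝ w (V j) - if i = j then 1 else 0| ≤ κ) :
    |inner ℝ w (∑ j, c j • V j) - c i| ≤ κ * ∑ j, c j := by
  have e : inner ℝ w (∑ j, c j • V j) - c i
      = ∑ j, c j * (inner ℝ w (V j) - if i = j then 1 else 0) := by
    simp [inner_sum, inner_smul_right, mul_sub]
  rw [e, Finset.mul_sum]
  refine (Finset.abs_sum_le_sum_abs _ _).trans (Finset.sum_le_sum fun j _ => ?_)
  rw [abs_mul, abs_of_nonneg (hc j), mul_comm]
  exact mul_le_mul_of_nonneg_right (hκ j) (hc j)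

theorem norm_sum_smul_le {E ι : Type*} [NormedAddCommGroup E] [NormedSpace ℝ E]
    [Fintype ι] (V : ι → E) (c : ι → ℝ) (κ : ℝ) (hc : ∀ j, 0 ≤ c j) (hκ : ∀ j, ‖V j‖ ≤ κ) :
    ‖∑ j, c j • V j‖ ≤ κ * ∑ j, c j := by
  rw [Finset.mul_sum]
  refine (norm_sum_le _ _).trans (Finset.sum_le_sum fun j _ => ?_)
  rw [norm_smul, Real.norm_of_nonneg (hc j), mul_comm]
  exact mul_le_mul_of_nonneg_right (hκ j) (hc j)

/-! ### Pointwise gradient bounds for a fixed code. -/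

section Deterministic

variable {n h : ℕ} {A W : Fin h → EuclideanSpace ℝ (Fin n)} {ξ δ : ℝ}

theorem norm_weight_le (hA : IsIncoherentDictionary A ξ) (hW : ∀ i, ‖W i - A i‖ ≤ δ) (hδ : δ ≤ 1)
    (i : Fin h) : ‖W i‖ ≤ 2 := by
  have := norm_add_le (W i - A i) (A i)
  rw [sub_add_cancel, hA.norm_eq_one] at this
  linarith [hW i]

theorem norm_signal_le (hA : IsIncoherentDictionary A ξ) {x : Fin h → ℝ} (hx : ∀ j, 0 ≤ x j) :
    ‖signal A x‖ ≤ ∑ j, x j := by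
  rw [signal, ← one_mul (∑ j, x j)]
  exact norm_sum_smul_le A x 1 hx fun j => (hA.norm_eq_one j).le

theorem abs_inner_weight_atom_sub_le (hA : IsIncoherentDictionary A ξ)
    (hW : ∀ i, ‖W i - A i‖ ≤ δ) (i j : Fin h) :
    |inner ℝ (W i) (A j) - if i = j then 1 else 0| ≤ δ + (h : ℝ) ^ (-ξ) := by
  have h0 : (0 : ℝ) ≤ (h : ℝ) ^ (-ξ) := by positivity
  have h1 : |inner ℝ (W i - A i) (A j)| ≤ δ := by
    refine (abs_real_inner_le_norm _ _).trans ?_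
    rw [hA.norm_eq_one, mul_one]
    exact hW i
  have h2 : |inner ℝ (A i) (A j) - if i = j then 1 else 0| ≤ (h : ℝ) ^ (-ξ) := by
    split_ifs with hij
    · subst hij
      rw [real_inner_self_eq_norm_sq, hA.norm_eq_one]
      simpa using h0
    · rw [sub_zero]
      exact hA.incoherent i j hij
  have e : inner ℝ (W i) (A j) - (if i = j then 1 else 0)
      = inner ℝ (W i - A i) (A j) + (inner ℝ (A i) (A j) - if i = j then 1 else 0) := by
    rw [inner_sub_left]
    ring
  rw [e]
  exact (abs_add_le _ _).trans (add_le_add h1 h2)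

theorem abs_inner_weight_weight_sub_le (hA : IsIncoherentDictionary A ξ)
    (hW : ∀ i, ‖W i - A i‖ ≤ δ) (hδ : δ ≤ 1) (i j : Fin h) :
    |inner ℝ (W i) (W j) - if i = j then 1 else 0| ≤ 3 * (δ + (h : ℝ) ^ (-ξ)) := by
  have h0 : (0 : ℝ) ≤ (h : ℝ) ^ (-ξ) := by positivity
  have h1 : |inner ℝ (W i) (W j - A j)| ≤ 2 * δ :=
    (abs_real_inner_le_norm _ _).trans
      (mul_le_mul (norm_weight_le hA hW hδ i) (hW j) (norm_nonneg _) zero_le_two)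
  have e : inner ℝ (W i) (W j) - (if i = j then 1 else 0)
      = inner ℝ (W i) (W j - A j) + (inner ℝ (W i) (A j) - if i = j then 1 else 0) := by
    rw [inner_sub_right]
    ring
  rw [e]
  refine (abs_add_le _ _).trans ?_
  linarith [abs_inner_weight_atom_sub_le hA hW i j]

theorem abs_inner_weight_signal_sub_le (hA : IsIncoherentDictionary A ξ)
    (hW : ∀ i, ‖W i - A i‖ ≤ δ) {x : Fin h → ℝ} (hx : ∀ j, 0 ≤ x j) (i : Fin h) :
    |inner ℝ (W i) (signal A x) - x i| ≤ (δ + (h : ℝ) ^ (-ξ)) * ∑ j, x j :=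
  abs_inner_sum_smul_sub_le _ _ _ _ _ hx (abs_inner_weight_atom_sub_le hA hW i)

/-- A unit outside the support of a code of moderate mass has vanishing gradient. -/
theorem aeGrad_eq_zero_of_code_eq_zero (hA : IsIncoherentDictionary A ξ)
    (hW : ∀ i, ‖W i - A i‖ ≤ δ) (hh : 0 < h) {ε : Fin h → ℝ} {θ : ℝ}
    (hε : ∀ i, ε i = θ * (δ + (h : ℝ) ^ (-ξ))) {x : Fin h → ℝ} (hx : ∀ j, 0 ≤ x j)
    (hθ : ∑ j, x j < θ) (τ : ℝ) (i : Fin h) (hi : x i = 0) :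
    aeGrad τ W ε (signal A x) i = 0 := by
  -- Strict positivity, which holds even for `δ = 0`, keeps the preactivation strictly below the
  -- bias, hence off the kink.
  have hη : 0 < δ + (h : ℝ) ^ (-ξ) :=
    add_pos_of_nonneg_of_pos ((norm_nonneg _).trans (hW i)) (by positivity)
  refine aeGrad_eq_zero_of_inner_lt _ _ _ _ _ ?_
  have h1 := abs_inner_weight_signal_sub_le hA hW hx i
  rw [hi, sub_zero] at h1
  rw [hε, mul_comm]
  exact (le_abs_self _).trans_lt (h1.trans_lt (mul_lt_mul_of_pos_left hθ hη))

/-- On codes of moderate mass the gradient is controlled by the bias. -/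
theorem norm_aeGrad_le_of_sum_lt (hA : IsIncoherentDictionary A ξ)
    (hW : ∀ i, ‖W i - A i‖ ≤ δ) (hδ : δ ≤ 1) {ε θ k : ℝ} (hk : 1 ≤ k)
    (hε : ε = θ * (δ + (h : ℝ) ^ (-ξ))) {x : Fin h → ℝ} (hx : ∀ j, 0 ≤ x j)
    (hθ : ∑ j, x j < θ) {S : Finset (Fin h)} (hS : ∀ j ∉ S, x j = 0) (hSk : (S.card : ℝ) ≤ k)
    {τ : ℝ} (hτ : τ ∈ Set.Icc (0 : ℝ) 1) (i : Fin h) :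
    ‖aeGrad τ W (fun _ => ε) (signal A x) i‖
      ≤ (x i + 2 * ε) * (5 * (ε * k)) + 6 * ε * θ := by
  set η := δ + (h : ℝ) ^ (-ξ) with hη_def
  have hδ0 : 0 ≤ δ := (norm_nonneg _).trans (hW i)
  have hδη : δ ≤ η := le_add_of_nonneg_right (by positivity)
  have hη : 0 ≤ η := hδ0.trans hδη
  have hT0 : 0 ≤ ∑ j, x j := Finset.sum_nonneg fun j _ => hx j
  have hTε : η * ∑ j, x j ≤ ε := by
    rw [hε, mul_comm]
    exact mul_le_mul_of_nonneg_right hθ.le hη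
  have hε0 : 0 ≤ ε := (mul_nonneg hη hT0).trans hTε
  have hy : ∀ j, |inner ℝ (W j) (signal A x) - x j| ≤ ε := fun j =>
    (abs_inner_weight_signal_sub_le hA hW hx j).trans hTε
  -- The activations satisfy `x j - 2 * ε ≤ r j ≤ x j`: the bias absorbs the error from above and at
  -- most doubles it from below.
  set r : Fin h → ℝ := fun j => max 0 (inner ℝ (W j) (signal A x) - ε) with hr
  have hr0 : ∀ j, 0 ≤ r j := fun j => le_max_left _ _
  have hrx : ∀ j, r j ≤ x j := fun j =>
    max_le (hx j) (by linarith [(abs_le.mp (hy j)).2])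
  have hxr : ∀ j, x j - r j ≤ 2 * ε := fun j => by
    have h1 : inner ℝ (W j) (signal A x) - ε ≤ r j := le_max_right _ _
    linarith [(abs_le.mp (hy j)).1]
  have hrT : ∑ j, r j ≤ ∑ j, x j := Finset.sum_le_sum fun j _ => hrx j
  have hout : autoencoder W (fun _ => ε) (signal A x) = ∑ j, r j • W j := rfl
  have hR : ‖autoencoder W (fun _ => ε) (signal A x) - signal A x‖ ≤ 5 * (ε * k) := by
    -- The residual splits into dictionary error, at most `ε`, and shrinkage, which lives on `S` and
    -- is at most `4 * ε * k`; `1 ≤ k` merges them.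
    have e : autoencoder W (fun _ => ε) (signal A x) - signal A x
        = ∑ j, x j • (W j - A j) - ∑ j, (x j - r j) • W j := by
      rw [hout, signal]
      simp only [smul_sub, sub_smul, Finset.sum_sub_distrib]
      abel
    have h1 : ‖∑ j, x j • (W j - A j)‖ ≤ ε :=
      (norm_sum_smul_le _ x η hx fun j => (hW j).trans hδη).trans hTε
    have h2 : ‖∑ j, (x j - r j) • W j‖ ≤ 2 * ∑ j, (x j - r j) :=
      norm_sum_smul_le _ _ 2 (fun j => sub_nonneg.mpr (hrx j)) (norm_weight_le hA hW hδ)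
    have h3 : ∑ j, (x j - r j) ≤ k * (2 * ε) := by
      have h4 : ∑ j, (x j - r j) = ∑ j ∈ S, (x j - r j) := by
        refine (Finset.sum_subset (Finset.subset_univ S) fun j _ hj => ?_).symm
        have := hrx j
        rw [hS j hj] at this ⊢
        linarith [hr0 j]
      rw [h4]
      refine (Finset.sum_le_card_nsmul _ _ _ fun j _ => hxr j).trans ?_
      rw [nsmul_eq_mul]
      exact mul_le_mul_of_nonneg_right hSk (by positivity)
    rw [e]
    refine (norm_sub_le _ _).trans ?_
    nlinarith [mul_le_mul_of_nonneg_left hk hε0]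
  -- Near-orthogonality of the rows avoids a factor `k` here: `3ε` from the output against `r i`,
  -- `2ε` from `r i` against `x i`, `ε` from `x i` against the signal.
  have hWR : |inner ℝ (W i) (autoencoder W (fun _ => ε) (signal A x) - signal A x)|
      ≤ 6 * ε := by
    have h1 := abs_inner_sum_smul_sub_le _ _ r i _ hr0
      (abs_inner_weight_weight_sub_le hA hW hδ i)
    rw [← hout] at h1
    have h2 : 3 * η * ∑ j, r j ≤ 3 * ε := by
      nlinarith [mul_le_mul_of_nonneg_left hrT hη]
    have h3 := abs_le.mp (h1.trans h2)
    have h4 := abs_le.mp (hy i)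
    rw [inner_sub_right, abs_le]
    constructor <;> linarith [hrx i, hxr i]
  have hin : |inner ℝ (W i) (signal A x) - ε| ≤ x i + 2 * ε := by
    have h4 := abs_le.mp (hy i)
    rw [abs_le]
    constructor <;> linarith [hx i]
  refine (norm_aeGrad_le hτ _ _ _ _).trans (add_le_add ?_ ?_)
  · exact mul_le_mul hin hR (norm_nonneg _) (by linarith [hx i])
  · exact mul_le_mul hWR ((norm_signal_le hA hx).trans hθ.le) (norm_nonneg _) (by positivity)

/-- A crude bound of the gradient, valid for all codes with entries in `[0, b]`. -/
theorem norm_aeGrad_le_of_le (hA : IsIncoherentDictionary A ξ)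
    (hW : ∀ i, ‖W i - A i‖ ≤ δ) (hδ : δ ≤ 1) {ε b : ℝ} (hε : 0 ≤ ε) (hεb : ε ≤ 4 * (h * b))
    {x : Fin h → ℝ} (hx : ∀ j, 0 ≤ x j) (hxb : ∀ j, x j ≤ b)
    {τ : ℝ} (hτ : τ ∈ Set.Icc (0 : ℝ) 1) (i : Fin h) :
    ‖aeGrad τ W (fun _ => ε) (signal A x) i‖ ≤ 40 * (h : ℝ) ^ 3 * b ^ 2 := by
  have hb : 0 ≤ b := (hx i).trans (hxb i)
  have hh : (1 : ℝ) ≤ h := by exact_mod_cast i.pos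
  have hy : ‖signal A x‖ ≤ h * b := by
    refine (norm_signal_le hA hx).trans ((Finset.sum_le_card_nsmul _ _ _ fun j _ => hxb j).trans ?_)
    simp
  have hin : ∀ j, |inner ℝ (W j) (signal A x)| ≤ 2 * (h * b) := fun j =>
    (abs_real_inner_le_norm _ _).trans
      (mul_le_mul (norm_weight_le hA hW hδ j) hy (norm_nonneg _) zero_le_two)
  have hout : ‖autoencoder W (fun _ => ε) (signal A x)‖ ≤ 4 * (h ^ 2 * b) := by
    refine (norm_sum_smul_le W _ 2 (fun j => le_max_left _ _) (norm_weight_le hA hW hδ)).trans ?_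
    have h1 : ∑ j, max 0 (inner ℝ (W j) (signal A x) - ε) ≤ h * (2 * (h * b)) := by
      refine (Finset.sum_le_card_nsmul _ _ (2 * (h * b)) fun j _ => ?_).trans ?_
      · exact max_le (by positivity) (by linarith [(abs_le.mp (hin j)).2])
      · simp
    nlinarith
  have hR : ‖autoencoder W (fun _ => ε) (signal A x) - signal A x‖ ≤ 5 * (h ^ 2 * b) := by
    refine (norm_sub_le _ _).trans ?_
    have : h * b ≤ h ^ 2 * b := mul_le_mul_of_nonneg_right (by nlinarith) hb
    linarith
  have hWR : |inner ℝ (W i) (autoencoder W (fun _ => ε) (signal A x) - signal A x)|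
      ≤ 2 * (5 * (h ^ 2 * b)) :=
    (abs_real_inner_le_norm _ _).trans
      (mul_le_mul (norm_weight_le hA hW hδ i) hR (norm_nonneg _) zero_le_two)
  have hin' : |inner ℝ (W i) (signal A x) - ε| ≤ 6 * (h * b) := by
    have h4 := abs_le.mp (hin i)
    rw [abs_le]
    constructor <;> nlinarith
  refine (norm_aeGrad_le hτ _ _ _ _).trans ?_
  calc _ ≤ 6 * (h * b) * (5 * (h ^ 2 * b)) + 2 * (5 * (h ^ 2 * b)) * (h * b) :=
        add_le_add (mul_le_mul hin' hR (norm_nonneg _) (by positivity))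
          (mul_le_mul hWR hy (norm_nonneg _) (by positivity))
    _ = _ := by ring

end Deterministic

theorem PMF.sum_toReal_eq_one {α : Type*} [Fintype α] (P : PMF α) :
    ∑ s, (P s).toReal = 1 := by
  have h1 : ∑ s, P s = 1 := by rw [← P.tsum_coe, tsum_fintype]
  rw [← ENNReal.toReal_sum fun s _ => P.apply_ne_top s, h1, ENNReal.toReal_one]

/-! ### Probabilistic estimates for the sparse code. -/

namespace IsSparseCode

variable {h : ℕ} {P : PMF (Finset (Fin h))} {D : Finset (Fin h) → Measure (Fin h → ℝ)}
  {p a b m₁ m₂ : ℝ} {S : Finset (Fin h)}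

theorem ae_eq_zero (hc : IsSparseCode P D p a b m₁ m₂) (hS : P S ≠ 0) :
    ∀ᵐ x ∂(D S), ∀ j ∉ S, x j = 0 := by
  refine ae_all_iff.mpr fun j => ?_
  by_cases hj : j ∈ S
  · exact Eventually.of_forall fun x hx => absurd hj hx
  · filter_upwards [hc.support_subset S hS j hj] with x hx _ using hx

theorem ae_mem_Icc (hc : IsSparseCode P D p a b m₁ m₂) (hS : P S ≠ 0) :
    ∀ᵐ x ∂(D S), ∀ j ∈ S, x j ∈ Set.Icc a b := by
  refine ae_all_iff.mpr fun j => ?_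
  by_cases hj : j ∈ S
  · filter_upwards [hc.mem_Icc S hS j hj] with x hx _ using hx
  · exact Eventually.of_forall fun x hx => absurd hx hj

theorem ae_nonneg (hc : IsSparseCode P D p a b m₁ m₂) (hS : P S ≠ 0) :
    ∀ᵐ x ∂(D S), ∀ j, 0 ≤ x j := by
  filter_upwards [hc.ae_eq_zero hS, hc.ae_mem_Icc hS] with x h0 h1 j
  by_cases hj : j ∈ S
  · exact hc.a_nonneg.trans (h1 j hj).1
  · exact (h0 j hj).ge

theorem integrable_apply (hc : IsSparseCode P D p a b m₁ m₂) (hS : P S ≠ 0) {i : Fin h}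
    (hi : i ∈ S) : Integrable (fun x => x i) (D S) := by
  have := hc.isProbabilityMeasure S hS
  exact Integrable.of_mem_Icc a b (measurable_pi_apply i).aemeasurable (hc.mem_Icc S hS i hi)

theorem mean_mem_Icc (hc : IsSparseCode P D p a b m₁ m₂) (hS : P S ≠ 0) (hne : S.Nonempty) :
    m₁ ∈ Set.Icc a b := by
  obtain ⟨i, hi⟩ := hne
  have := hc.isProbabilityMeasure S hS
  have hint := hc.integrable_apply hS hi
  rw [← hc.mean_eq S hS i hi]
  constructor
  · simpa using integral_mono_ae (integrable_const a) hint
      ((hc.mem_Icc S hS i hi).mono fun x hx => hx.1)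
  · simpa using integral_mono_ae hint (integrable_const b)
      ((hc.mem_Icc S hS i hi).mono fun x hx => hx.2)

/-- Tail bound for the total mass of the code. -/
theorem measureReal_le_sum_le (hc : IsSparseCode P D p a b m₁ m₂) (hS : P S ≠ 0) (hh : 0 < h)
    (hm : 0 < m₁) :
    (D S).real {x | 2 * m₁ * (h : ℝ) ^ p ≤ ∑ j ∈ S, x j}
      ≤ Real.exp (-((h : ℝ) ^ p * m₁ ^ 2 / (2 * (b - a) ^ 2))) := by
  have := hc.isProbabilityMeasure S hS
  have hk : 0 < (h : ℝ) ^ p := by positivity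
  rcases S.eq_empty_or_nonempty with rfl | hne
  · have : ¬ 2 * m₁ * (h : ℝ) ^ p ≤ 0 := not_le.mpr (by positivity)
    simp [this, Real.exp_nonneg]
  have hsub : ∀ j ∈ (Finset.univ : Finset S), HasSubgaussianMGF
      (fun x : Fin h → ℝ => x j - m₁) ((‖b - a‖₊ / 2) ^ 2) (D S) := fun j _ => by
    have := hasSubgaussianMGF_of_mem_Icc (measurable_pi_apply (j : Fin h)).aemeasurable
      (hc.mem_Icc S hS j j.2)
    rwa [hc.mean_eq S hS j j.2] at this
  have hind : iIndepFun (fun (j : S) (x : Fin h → ℝ) => x j - m₁) (D S) :=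
    (hc.indep S hS).comp (fun _ t => t - m₁) fun _ => measurable_id.sub_const m₁
  -- Since `S.card ≤ h ^ p`, the sum of the means is at most `m₁ * h ^ p`, so the event forces a
  -- deviation of at least `m₁ * h ^ p`.
  have key := HasSubgaussianMGF.measure_sum_ge_le_of_iIndepFun hind hsub
    (ε := m₁ * (h : ℝ) ^ p) (by positivity)
  have hcard := hc.card_le S hS
  refine (measureReal_mono ?_).trans (key.trans ?_)
  · intro x hx
    simp only [Set.mem_ofPred_eq] at hx ⊢
    rw [Finset.sum_coe_sort S (fun j => x j - m₁), Finset.sum_sub_distrib, Finset.sum_const,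
      nsmul_eq_mul]
    nlinarith
  · refine Real.exp_le_exp.mpr ?_
    rw [neg_div, neg_le_neg_iff]
    -- For `a = b` both exponents are quotients by zero, hence zero.
    rcases eq_or_ne b a with rfl | hba
    · simp
    have hpos : 0 < (b - a) ^ 2 := by
      have := sub_ne_zero.mpr hba
      positivity
    have hS0 : (0 : ℝ) < S.card := by exact_mod_cast hne.card_pos
    have e : 2 * ((∑ i : S, (‖b - a‖₊ / 2) ^ 2 : NNReal) : ℝ) = S.card * (b - a) ^ 2 / 2 := by
      simp [div_pow]
      ring
    rw [e, div_le_div_iff₀ (by positivity) (by positivity)]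
    have h2 : (S.card : ℝ) * (b - a) ^ 2 ≤ (h : ℝ) ^ p * (b - a) ^ 2 :=
      mul_le_mul_of_nonneg_right hcard hpos.le
    have h3 := mul_le_mul_of_nonneg_left h2 (by positivity : 0 ≤ (h : ℝ) ^ p * m₁ ^ 2)
    have h4 : 0 ≤ (h : ℝ) ^ p * m₁ ^ 2 * ((h : ℝ) ^ p * (b - a) ^ 2) := by positivity
    nlinarith

/-- Each index lies in the support with probability at most `h ^ (p - 1)`. -/
theorem sum_prob_mem_le (hc : IsSparseCode P D p a b m₁ m₂) (i : Fin h) :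
    ∑ S, (P S).toReal * (if i ∈ S then 1 else 0) ≤ (h : ℝ) ^ (p - 1) := by
  have hh : (0 : ℝ) < h := by exact_mod_cast i.pos
  obtain ⟨q, hq⟩ := hc.prob_single
  have hmass : ∀ j, ∑ S, (P S).toReal * (if j ∈ S then 1 else 0) = q.toReal := fun j => by
    rw [← hq j, PMF.toOuterMeasure_apply, tsum_fintype, ENNReal.toReal_sum]
    · refine Finset.sum_congr rfl fun S _ => ?_
      by_cases hj : j ∈ S <;> simp [hj]
    · intro S _
      by_cases hj : j ∈ S <;> simp [hj, P.apply_ne_top]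
  -- Double counting: the membership probabilities add up to the expected size of the support.
  have hsum : h * q.toReal ≤ (h : ℝ) ^ p := by
    calc h * q.toReal = ∑ j : Fin h, ∑ S, (P S).toReal * (if j ∈ S then 1 else 0) := by
          simp only [hmass]
          simp
      _ = ∑ S, (P S).toReal * (S.card : ℝ) := by
          rw [Finset.sum_comm]
          refine Finset.sum_congr rfl fun S _ => ?_
          rw [← Finset.mul_sum]
          simp
      _ ≤ ∑ S, (P S).toReal * (h : ℝ) ^ p := by
          refine Finset.sum_le_sum fun S _ => ?_
          by_cases hS : P S = 0
          · simp [hS]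
          · exact mul_le_mul_of_nonneg_left (hc.card_le S hS) ENNReal.toReal_nonneg
      _ = (h : ℝ) ^ p := by rw [← Finset.sum_mul, P.sum_toReal_eq_one, one_mul]
  rw [hmass, Real.rpow_sub_one hh.ne', le_div_iff₀ hh]
  linarith

/-- Integration against the law of the code, conditionally on the support. -/
theorem integrable_and_norm_integral_le {E : Type*} [NormedAddCommGroup E] [NormedSpace ℝ E]
    (hc : IsSparseCode P D p a b m₁ m₂) {f : (Fin h → ℝ) → E} (i : Fin h) {B₁ B₂ : ℝ}
    (hB₁ : 0 ≤ B₁)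
    (hf : ∀ S, P S ≠ 0 → Integrable f (D S) ∧
      ‖∫ x, f x ∂(D S)‖ ≤ (if i ∈ S then 1 else 0) * B₁ + B₂) :
    Integrable f (codeLaw P D) ∧ ‖∫ x, f x ∂(codeLaw P D)‖ ≤ (h : ℝ) ^ (p - 1) * B₁ + B₂ := by
  have hint : ∀ S ∈ (Finset.univ : Finset (Finset (Fin h))), Integrable f (P S • D S) := by
    intro S _
    by_cases hS : P S = 0
    · simp [hS]
    · exact (hf S hS).1.smul_measure (P.apply_ne_top S)
  refine ⟨integrable_finsetSum_measure.mpr hint, ?_⟩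
  rw [codeLaw, integral_finsetSum_measure hint]
  calc ‖∑ S, ∫ x, f x ∂(P S • D S)‖
      ≤ ∑ S, (P S).toReal * ((if i ∈ S then 1 else 0) * B₁ + B₂) := by
        refine (norm_sum_le _ _).trans (Finset.sum_le_sum fun S _ => ?_)
        rw [integral_smul_measure, norm_smul, Real.norm_of_nonneg ENNReal.toReal_nonneg]
        by_cases hS : P S = 0
        · simp [hS]
        · exact mul_le_mul_of_nonneg_left (hf S hS).2 ENNReal.toReal_nonneg
    _ = (∑ S, (P S).toReal * (if i ∈ S then 1 else 0)) * B₁ + B₂ := by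
        simp only [mul_add, Finset.sum_add_distrib, ← mul_assoc, ← Finset.sum_mul,
          P.sum_toReal_eq_one, one_mul]
    _ ≤ (h : ℝ) ^ (p - 1) * B₁ + B₂ := by
        gcongr
        exact hc.sum_prob_mem_le i

end IsSparseCode

/-! ### Combining the typical and the atypical codes. -/

/-- Non-asymptotic bound of the expected gradient. -/
theorem norm_integral_aeGrad_le {n h : ℕ} {A W : Fin h → EuclideanSpace ℝ (Fin n)}
    {P : PMF (Finset (Fin h))} {D : Finset (Fin h) → Measure (Fin h → ℝ)}
    {p ξ a b m₁ m₂ δ ρ K : ℝ} (hp0 : 0 ≤ p) (hp1 : p ≤ 1) (hξ : 0 ≤ ξ)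
    (hA : IsIncoherentDictionary A ξ) (hc : IsSparseCode P D p a b m₁ m₂)
    (hW : ∀ i, ‖W i - A i‖ ≤ δ) (hδ : δ ≤ 1) (hm : 0 < m₁) (hK : 0 ≤ K) (hb : b ≤ K * a)
    (hρ : 2 * ((h : ℝ) ^ p) ^ 2 * (δ + (h : ℝ) ^ (-ξ)) ≤ ρ) (hρ1 : ρ ≤ 1)
    {τ : ℝ} (hτ : τ ∈ Set.Icc (0 : ℝ) 1) (i : Fin h) :
    Integrable (fun x => aeGrad τ W (aeBias h p ξ m₁ δ) (signal A x) i) (codeLaw P D) ∧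
      ‖∫ x, aeGrad τ W (aeBias h p ξ m₁ δ) (signal A x) i ∂(codeLaw P D)‖
        ≤ (h : ℝ) ^ (p - 1) * (27 * ρ * m₁ ^ 2) + 40 * (h : ℝ) ^ 3 * (K * m₁) ^ 2 *
          Real.exp (-((h : ℝ) ^ p * m₁ ^ 2 / (2 * (b - a) ^ 2))) := by
  have hh : (1 : ℝ) ≤ h := by exact_mod_cast i.pos
  set k := (h : ℝ) ^ p with hk_def
  have hk : 1 ≤ k := Real.one_le_rpow hh hp0
  have hkh : k ≤ h := by simpa using Real.rpow_le_rpow_of_exponent_le hh hp1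
  set η := δ + (h : ℝ) ^ (-ξ) with hη_def
  have hη0 : 0 ≤ η := add_nonneg ((norm_nonneg _).trans (hW i)) (by positivity)
  have hη2 : η ≤ 2 := by
    have : (h : ℝ) ^ (-ξ) ≤ 1 := Real.rpow_le_one_of_one_le_of_nonpos hh (by linarith)
    linarith
  set ε := 2 * m₁ * k * η with hε_def
  have hε0 : 0 ≤ ε := by positivity
  have hbias : aeBias h p ξ m₁ δ = fun _ => ε := rfl
  have hεk : ε * k ≤ m₁ * ρ := by
    have := mul_le_mul_of_nonneg_left hρ hm.le
    calc ε * k = m₁ * (2 * k ^ 2 * η) := by rw [hε_def]; ring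
      _ ≤ _ := this
  have hεm : ε ≤ m₁ := by nlinarith [mul_le_mul_of_nonneg_left hk hε0]
  have hρ0 : 0 ≤ ρ := le_trans (by positivity) hρ
  refine hc.integrable_and_norm_integral_le i (by positivity) fun S hS => ?_
  have := hc.isProbabilityMeasure S hS
  rw [hbias]
  set T : Set (Fin h → ℝ) := {x | 2 * m₁ * k ≤ ∑ j ∈ S, x j}
  have hT : MeasurableSet T := measurableSet_le measurable_const (by fun_prop)
  set C := 40 * (h : ℝ) ^ 3 * (K * m₁) ^ 2
  have hC : 0 ≤ C := by positivity
  -- Majorant off `T`, from `ε ≤ m₁` and `ε * k ≤ m₁ * ρ`: the constant `22` is `10 + 12`, and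
  -- integrating `x i` to `m₁` gives `27 = 5 + 22`.
  set H : (Fin h → ℝ) → ℝ := fun x =>
    if i ∈ S then 5 * ρ * m₁ * x i + 22 * ρ * m₁ ^ 2 else 0 with hH_def
  have hH : Integrable H (D S) ∧
      ∫ x, H x ∂(D S) = (if i ∈ S then 1 else 0) * (27 * ρ * m₁ ^ 2) := by
    by_cases hi : i ∈ S
    · have hx := (hc.integrable_apply hS hi).const_mul (5 * ρ * m₁)
      simp only [hH_def, if_pos hi]
      refine ⟨hx.add (integrable_const _), ?_⟩
      rw [integral_add hx (integrable_const _), integral_const_mul, hc.mean_eq S hS i hi]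
      simp
      ring
    · simp [hH_def, hi]
  have hind : Integrable (T.indicator fun _ => C) (D S) := (integrable_const C).indicator hT
  have hbound : ∀ᵐ x ∂(D S), ‖aeGrad τ W (fun _ => ε) (signal A x) i‖
      ≤ H x + T.indicator (fun _ => C) x := by
    filter_upwards [hc.ae_eq_zero hS, hc.ae_mem_Icc hS, hc.ae_nonneg hS] with x h0 hab hx
    have hH0 : 0 ≤ H x := by
      have := hx i
      simp only [hH_def]
      split_ifs <;> positivity
    by_cases hxT : x ∈ T
    · rw [Set.indicator_of_mem hxT]
      have hne : S.Nonempty := by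
        by_contra hne
        rw [Finset.not_nonempty_iff_eq_empty] at hne
        have h1 : 2 * m₁ * k ≤ ∑ j ∈ S, x j := hxT
        rw [hne, Finset.sum_empty] at h1
        have : 0 < 2 * m₁ * k := by positivity
        linarith
      have hmean := hc.mean_mem_Icc hS hne
      have hb0 : 0 ≤ b := hm.le.trans hmean.2
      have hxb : ∀ j, x j ≤ b := fun j => by
        by_cases hj : j ∈ S
        · exact (hab j hj).2
        · rw [h0 j hj]; exact hb0
      have hεb : ε ≤ 4 * (h * b) := by
        calc ε ≤ 2 * b * h * 2 := by
              rw [hε_def]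
              have := hmean.2
              gcongr
          _ = _ := by ring
      have hbK : b ≤ K * m₁ := hb.trans (mul_le_mul_of_nonneg_left hmean.1 hK)
      have h1 := norm_aeGrad_le_of_le hA hW hδ hε0 hεb hx hxb hτ i
      have h2 : 40 * (h : ℝ) ^ 3 * b ^ 2 ≤ C := by
        simp only [C]
        gcongr
      linarith
    · rw [Set.indicator_of_notMem hxT, add_zero]
      have hsum : ∑ j, x j < 2 * m₁ * k := by
        have h1 : ∑ j ∈ S, x j < 2 * m₁ * k := not_le.mp hxT
        rwa [Finset.sum_subset (Finset.subset_univ S) fun j _ hj => h0 j hj] at h1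
      by_cases hi : i ∈ S
      · have h1 := norm_aeGrad_le_of_sum_lt hA hW hδ hk rfl hx hsum h0 (hc.card_le S hS) hτ i
        simp only [hH_def, if_pos hi]
        refine h1.trans ?_
        have h2 : (x i + 2 * ε) * (5 * (ε * k)) ≤ (x i + 2 * m₁) * (5 * (m₁ * ρ)) := by
          have := hx i
          gcongr
        have h3 : 6 * ε * (2 * m₁ * k) ≤ 12 * m₁ * (m₁ * ρ) := by
          calc 6 * ε * (2 * m₁ * k) = 12 * m₁ * (ε * k) := by ring
            _ ≤ _ := by gcongr
        exact (add_le_add h2 h3).trans_eq (by ring)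
      · rw [aeGrad_eq_zero_of_code_eq_zero hA hW i.pos (fun _ => rfl) hx hsum τ i (h0 i hi),
          norm_zero]
        exact hH0
  have hmeas : Measurable fun x => aeGrad τ W (fun _ => ε) (signal A x) i :=
    (measurable_aeGrad τ W (fun _ => ε) i).comp (continuous_signal A).measurable
  refine ⟨(hH.1.add hind).mono' hmeas.aestronglyMeasurable hbound, ?_⟩
  refine (norm_integral_le_of_norm_le (hH.1.add hind) hbound).trans ?_
  rw [integral_add' hH.1 hind, hH.2, integral_indicator_const _ hT, smul_eq_mul, mul_comm _ C]
  gcongr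
  exact hc.measureReal_le_sum_le hS i.pos hm

/-! ### Asymptotics in `h`. -/

theorem tendsto_natCast_rpow_neg {s : ℝ} (hs : s < 0) :
    Tendsto (fun h : ℕ => (h : ℝ) ^ s) atTop (nhds 0) := by
  have h1 := (tendsto_rpow_neg_atTop (neg_pos.mpr hs)).comp (tendsto_natCast_atTop_atTop (R := ℝ))
  rw [neg_neg] at h1
  exact h1

theorem theorem3p2
    (p ν ξ : ℝ) (hp0 : 0 < p) (hp1 : p < min (1 / 2) (ν ^ 2)) (hν : 0 < ν)
    (hξ : p + ν ^ 2 < ξ)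
    (n : ℕ → ℕ) (A : (h : ℕ) → Fin h → EuclideanSpace ℝ (Fin (n h)))
    (hA : ∀ h, IsIncoherentDictionary (A h) ξ)
    (a b m₁ m₂ : ℕ → ℝ)
    (P : (h : ℕ) → PMF (Finset (Fin h)))
    (D : (h : ℕ) → Finset (Fin h) → Measure (Fin h → ℝ))
    (hcode : ∀ h, IsSparseCode (P h) (D h) p (a h) (b h) (m₁ h) (m₂ h))
    (hab : (fun h : ℕ => b h * (h : ℝ) ^ (-ν ^ 2)) =O[atTop] a)
    (δ : ℕ → ℝ) (hδ : δ =O[atTop] fun h : ℕ => (h : ℝ) ^ (-p - ν ^ 2))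
    (hsuper : Superpolynomial fun h =>
      Real.exp ((h : ℝ) ^ p * m₁ h ^ 2 / (2 * (b h - a h) ^ 2))) :
    ∃ g : ℕ → ℝ,
      g =o[atTop] (fun h : ℕ => max (m₁ h ^ 2) (m₂ h) / (h : ℝ) ^ (1 - p)) ∧
      ∀ᶠ h : ℕ in atTop, ∀ W : Fin h → EuclideanSpace ℝ (Fin (n h)),
        (∀ i, ‖W i - A h i‖ ≤ δ h) → ∀ τ ∈ Set.Icc (0 : ℝ) 1, ∀ i : Fin h,
          Integrable
            (fun x => aeGrad τ W (aeBias h p ξ (m₁ h) (δ h)) (signal (A h) x) i)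
            (codeLaw (P h) (D h)) ∧
          ‖∫ x, aeGrad τ W (aeBias h p ξ (m₁ h) (δ h)) (signal (A h) x) i
            ∂(codeLaw (P h) (D h))‖ ≤ g h := by
  obtain ⟨C₀, hC₀, hδ'⟩ := hδ.exists_pos
  obtain ⟨C₂, hC₂, hab'⟩ := hab.exists_pos
  have hpν : p < ν ^ 2 := hp1.trans_le (min_le_right _ _)
  have hp2 : p < 1 / 2 := hp1.trans_le (min_le_left _ _)
  -- Large enough that `3 + 2 * ν ^ 2 ≤ d + (p - 1)`: the crude bound costs `h ^ 3` and the squared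
  -- ratio `b / a`, and a factor `h ^ (p - 1)` must remain.
  set d := ⌈4 + 2 * ν ^ 2⌉₊ with hd
  set E : ℕ → ℝ := fun h => (h : ℝ) ^ p * m₁ h ^ 2 / (2 * (b h - a h) ^ 2) with hE
  set ρ : ℕ → ℝ := fun h => 2 * (C₀ + 1) * (h : ℝ) ^ (p - ν ^ 2) with hρ
  have hρ0 : Tendsto ρ atTop (nhds 0) := by
    simpa using (tendsto_natCast_rpow_neg (sub_neg.mpr hpν)).const_mul (2 * (C₀ + 1))
  have hF0 : Tendsto (fun h : ℕ => (h : ℝ) ^ d / Real.exp (E h)) atTop (nhds 0) :=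
    (hsuper d).tendsto_div_nhds_zero
  refine ⟨fun h => (27 * ρ h + 40 * C₂ ^ 2 * ((h : ℝ) ^ d / Real.exp (E h))) *
    (m₁ h ^ 2 / (h : ℝ) ^ (1 - p)), ?_, ?_⟩
  · have hu : Tendsto (fun h => 27 * ρ h + 40 * C₂ ^ 2 * ((h : ℝ) ^ d / Real.exp (E h)))
        atTop (nhds 0) := by
      simpa using (hρ0.const_mul 27).add (hF0.const_mul (40 * C₂ ^ 2))
    have hO : (fun h : ℕ => m₁ h ^ 2 / (h : ℝ) ^ (1 - p)) =O[atTop]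
        fun h : ℕ => max (m₁ h ^ 2) (m₂ h) / (h : ℝ) ^ (1 - p) := by
      refine IsBigO.of_bound' (Eventually.of_forall fun h => ?_)
      have h1 : m₁ h ^ 2 / (h : ℝ) ^ (1 - p) ≤ max (m₁ h ^ 2) (m₂ h) / (h : ℝ) ^ (1 - p) := by
        gcongr
        exact le_max_left _ _
      have h0 : 0 ≤ m₁ h ^ 2 / (h : ℝ) ^ (1 - p) := by positivity
      rwa [Real.norm_of_nonneg h0, Real.norm_of_nonneg (h0.trans h1)]
    simpa using ((isLittleO_one_iff ℝ).mpr hu).mul_isBigO hO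
  have hδ1 : ∀ᶠ h : ℕ in atTop, C₀ * (h : ℝ) ^ (-p - ν ^ 2) ≤ 1 := by
    have : Tendsto (fun h : ℕ => C₀ * (h : ℝ) ^ (-p - ν ^ 2)) atTop (nhds 0) := by
      simpa using (tendsto_natCast_rpow_neg
        (by linarith [sq_nonneg ν] : -p - ν ^ 2 < 0)).const_mul C₀
    exact this.eventually_le_const one_pos
  filter_upwards [hδ'.bound, hab'.bound, (hsuper 1).bound one_pos,
    hρ0.eventually_le_const one_pos, hδ1, eventually_ge_atTop 2]
    with h hδh habh hFh hρh hδ1h hh W hW τ hτ i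
  have hh2 : (2 : ℝ) ≤ h := by exact_mod_cast hh
  have hh0 : (0 : ℝ) < h := by linarith
  have hh1 : (1 : ℝ) ≤ h := by linarith
  have hδle : δ h ≤ C₀ * (h : ℝ) ^ (-p - ν ^ 2) := by
    rw [Real.norm_of_nonneg (by positivity : 0 ≤ (h : ℝ) ^ (-p - ν ^ 2))] at hδh
    exact (le_abs_self _).trans hδh
  -- If `m₁ h = 0`, the exponential is `1`, and its domination of `h` contradicts `2 ≤ h`.
  have hm : 0 < m₁ h := by
    refine lt_of_le_of_ne (hcode h).mean_nonneg fun hm0 => ?_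
    simp [← hm0] at hFh
    linarith
  have hb : b h ≤ C₂ * (h : ℝ) ^ (ν ^ 2) * a h := by
    rw [Real.norm_of_nonneg (hcode h).a_nonneg] at habh
    have h1 := (le_abs_self _).trans habh
    rw [Real.rpow_neg hh0.le, ← div_eq_mul_inv, div_le_iff₀ (by positivity)] at h1
    linarith
  have hη : 2 * ((h : ℝ) ^ p) ^ 2 * (δ h + (h : ℝ) ^ (-ξ)) ≤ ρ h := by
    have h1 : (h : ℝ) ^ (-ξ) ≤ (h : ℝ) ^ (-p - ν ^ 2) :=
      Real.rpow_le_rpow_of_exponent_le hh1 (by linarith)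
    calc 2 * ((h : ℝ) ^ p) ^ 2 * (δ h + (h : ℝ) ^ (-ξ))
        ≤ 2 * ((h : ℝ) ^ p) ^ 2 * ((C₀ + 1) * (h : ℝ) ^ (-p - ν ^ 2)) := by
          gcongr
          linarith
      _ = 2 * (C₀ + 1) * ((h : ℝ) ^ p * (h : ℝ) ^ p * (h : ℝ) ^ (-p - ν ^ 2)) := by ring
      _ = ρ h := by
          rw [← Real.rpow_add hh0, ← Real.rpow_add hh0, hρ]
          ring_nf
  obtain ⟨hint, hle⟩ := norm_integral_aeGrad_le hp0.le (by linarith)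
    (by linarith [sq_nonneg ν]) (hA h) (hcode h) hW (hδle.trans hδ1h) hm (by positivity) hb hη
    hρh hτ i
  refine ⟨hint, hle.trans ?_⟩
  have hpow : (h : ℝ) ^ 3 * ((h : ℝ) ^ (ν ^ 2)) ^ 2 ≤ (h : ℝ) ^ d * (h : ℝ) ^ (p - 1) := by
    rw [← Real.rpow_natCast (h : ℝ) 3, ← Real.rpow_natCast (h : ℝ) d, sq ((h : ℝ) ^ (ν ^ 2)),
      ← Real.rpow_add hh0, ← Real.rpow_add hh0, ← Real.rpow_add hh0]
    refine Real.rpow_le_rpow_of_exponent_le hh1 ?_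
    have := Nat.le_ceil (4 + 2 * ν ^ 2)
    push_cast
    linarith
  have hinv : 1 / (h : ℝ) ^ (1 - p) = (h : ℝ) ^ (p - 1) := by
    rw [one_div, ← Real.rpow_neg hh0.le, neg_sub]
  rw [Real.exp_neg, div_eq_mul_one_div (m₁ h ^ 2), hinv]
  calc (h : ℝ) ^ (p - 1) * (27 * ρ h * m₁ h ^ 2)
        + 40 * (h : ℝ) ^ 3 * (C₂ * (h : ℝ) ^ (ν ^ 2) * m₁ h) ^ 2 * (Real.exp (E h))⁻¹
      = (h : ℝ) ^ (p - 1) * (27 * ρ h * m₁ h ^ 2)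
        + 40 * C₂ ^ 2 * m₁ h ^ 2 * (Real.exp (E h))⁻¹ *
          ((h : ℝ) ^ 3 * ((h : ℝ) ^ (ν ^ 2)) ^ 2) := by ring
    _ ≤ (h : ℝ) ^ (p - 1) * (27 * ρ h * m₁ h ^ 2)
        + 40 * C₂ ^ 2 * m₁ h ^ 2 * (Real.exp (E h))⁻¹ *
          ((h : ℝ) ^ d * (h : ℝ) ^ (p - 1)) := by gcongr
    _ = _ := by ring
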